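/- All graphs are finite and simple. A graph is disconnected if it has two vertices that are not joined by a path, and $G^c$ denotes the complement of $G$ on the same vertex set. For a field $k$ and a graph $G$ with vertices $x_1,\dots,x_n$, let $R=k[x_1,\dots,x_n]$, let $I(G)\subseteq R$ be the ideal generated by the monomials $x_ix_j$ for all edges $\{x_i,x_j\}$ of $G$, and let $\operatorname{pd}^k(G)$ be the projective dimension of the $R$-module $R/I(G)$. **Theorem.** Let $k$ be any field and $G$ a graph. 1. If $H$ is an induced subgraph of $G$ such that $H^c$ is disconnected, then $\operatorname{pd}^k(G)\ge |V(H)|-1$. 2. If $G^c$ is disconnected, then $\operatorname{pd}^k(G)=|V(G)|-1$. 3. If the complete graph $K_n$ ($n\ge 2$) is isomorphic to an induced subgraph of $G$, then $\operatorname{pd}^k(G)\ge n-1$; if the complete bipartite graph $K_{n,m}$ ($n,m\ge 1$) is isomorphic to an induced subgraph of $G$, then $\operatorname{pd}^k(G)\ge n+m-1$. 4. $\operatorname{pd}^k(K_n)=n-1$ for $n\ge 2$, and $\operatorname{pd}^k(K_{n,m})=n+m-1$ for $n,m\ge 1$. -/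

import Mathlib

/-- The graph ideal `I(G)` of the polynomial ring over `k` with one variable per vertex,
generated by the monomials `x_i x_j` for the edges `{x_i, x_j}` of `G`. -/
noncomputable def graphIdeal (k : Type*) [Field k] {V : Type*} (G : SimpleGraph V) :
    Ideal (MvPolynomial V k) :=
  Ideal.span {f | ∃ i j : V, G.Adj i j ∧ f = MvPolynomial.X i * MvPolynomial.X j}

/-- The projective dimension of a graph over `k`: the projective dimension of the quotient of the
polynomial ring by the graph ideal, as a module over the polynomial ring. -/
noncomputable def graphPd (k : Type*) [Field k] {V : Type*} (G : SimpleGraph V) : WithBot ℕ∞ :=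
  CategoryTheory.projectiveDimension
    (ModuleCat.of (MvPolynomial V k) (MvPolynomial V k ⧸ graphIdeal k G))

/-!
Write `(X_S)` for the ideal generated by the variables in `S`, and let `I` be the edge ideal.

Lower bound: the complement of a graph is disconnected exactly when the graph is the join of two
nonempty parts, so suppose that every vertex of `A` is adjacent to every vertex of `B`, whence
`(X_A) ∩ (X_B) ⊆ I`. The map `(X_A) + (X_B) → R/I` that is the projection on `(X_A)` and zero on
`(X_B)` is not multiplication by an element: the constant term of such an element would be both
`1` and `0`. Hence `Ext¹(R/(X_A, X_B), R/I) ≠ 0`. On the other hand, dimension shifting shows that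
`Extⁱ(N, M) = 0` as soon as `i + pd M` is smaller than the length of a regular sequence that
annihilates `N`, and the variables in `A ∪ B` form such a sequence.

Upper bound: for `J = I + (X_S)` the exact sequence `0 → R/(J : x) → R/J → R/(J + (x)) → 0`, with
`x` an endpoint of an edge that avoids `S`, reduces to the sets `S ∪ N(x)` and `S ∪ {x}`, neither of
which is the whole vertex set. Eventually `S` is a vertex cover, where `J = (X_S)` is generated by a
regular sequence of fewer than `|V|` variables.
-/

open CategoryTheory Abelian RingTheory.Sequence

section ProjectiveDimension

universe u v

theorem coe_le_projectiveDimension {C : Type*} [Category* C] [Abelian C] {X : C}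
    (hX : ¬ Limits.IsZero X) {e : ℕ∞} (h : ∀ p : ℕ, HasProjectiveDimensionLE X p → e ≤ p) :
    (e : WithBot ℕ∞) ≤ projectiveDimension X := by
  obtain ⟨d, hd⟩ := WithBot.ne_bot_iff_exists.1 ((projectiveDimension_eq_bot_iff X).not.2 hX)
  rw [← hd, WithBot.coe_le_coe]
  induction d using ENat.recTopCoe with
  | top => exact le_top
  | coe p => exact h p ((projectiveDimension_le_iff X p).1 hd.ge)

variable {R : Type u} [CommRing R]

theorem ker_toSpanSingleton_mkQ {M : Type*} [AddCommGroup M] [Module R M]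
    (N : Submodule R M) (m : M) :
    (LinearMap.toSpanSingleton R (M ⧸ N) (N.mkQ m)).ker = N.colon {m} := by
  ext r
  rw [LinearMap.mem_ker, LinearMap.toSpanSingleton_apply, ← map_smul, Submodule.mem_colon_singleton,
    Submodule.mkQ_apply, Submodule.Quotient.mk_eq_zero]

theorem exact_colon {M : Type*} [AddCommGroup M] [Module R M]
    (N : Submodule R M) (m : M) :
    Function.Exact ((N.colon {m}).liftQ _ (ker_toSpanSingleton_mkQ N m).ge)
      (Submodule.factor (le_sup_left : N ≤ N ⊔ R ∙ m)) := by
  rw [LinearMap.exact_iff, Submodule.range_liftQ, LinearMap.range_toSpanSingleton, Submodule.factor,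
    Submodule.ker_mapQ, Submodule.comap_id, Submodule.map_sup, Submodule.map_span,
    Set.image_singleton, Submodule.mkQ_map_self, bot_sup_eq]

/-- The sequence `R ⧸ (N : m) ⟶ M ⧸ N ⟶ M ⧸ (N + Rm)` whose first map is multiplication by
`m`, along which projective dimensions of quotients of `M` are compared. -/
noncomputable def colonShortComplex {M : Type u} [AddCommGroup M] [Module R M]
    (N : Submodule R M) (m : M) : ShortComplex (ModuleCat.{u} R) :=
  ModuleCat.shortComplexOfCompEqZero
    ((N.colon {m}).liftQ _ (ker_toSpanSingleton_mkQ N m).ge)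
    (Submodule.factor (le_sup_left : N ≤ N ⊔ R ∙ m)) (exact_colon N m).linearMap_comp_eq_zero

theorem colonShortComplex_shortExact {M : Type u} [AddCommGroup M] [Module R M]
    (N : Submodule R M) (m : M) : (colonShortComplex N m).ShortExact :=
  ModuleCat.shortComplex_shortExact _ (exact_colon N m)
    (LinearMap.ker_eq_bot.1 (Submodule.ker_liftQ_eq_bot _ _ _ (ker_toSpanSingleton_mkQ N m).le))
    (Submodule.factor_surjective le_sup_left)

theorem hasProjectiveDimensionLT_quotient_of_isWeaklyRegular (M : ModuleCat.{v} R) {n : ℕ}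
    [HasProjectiveDimensionLT M n] {rs : List R} (reg : IsWeaklyRegular M rs) :
    HasProjectiveDimensionLT
      (ModuleCat.of R (M ⧸ (Ideal.ofList rs • ⊤ : Submodule R M))) (n + rs.length) := by
  induction rs generalizing M n with
  | nil =>
    rw [Ideal.ofList_nil, Submodule.bot_smul]
    exact hasProjectiveDimensionLT_of_iso (Submodule.quotEquivOfEqBot ⊥ rfl).symm.toModuleIso n
  | cons r rs ih =>
    obtain ⟨hr, hrs⟩ := (isWeaklyRegular_cons_iff M r rs).1 reg
    have : HasProjectiveDimensionLT (ModuleCat.of R (QuotSMulTop r M)) (n + 1) :=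
      hr.smulShortComplex_shortExact.hasProjectiveDimensionLT_X₃ n ‹_›
        (hasProjectiveDimensionLT_of_ge M n (n + 1) n.le_succ)
    rw [List.length_cons, add_comm rs.length, ← add_assoc]
    have := ih (ModuleCat.of R (QuotSMulTop r M)) (n := n + 1) hrs
    exact hasProjectiveDimensionLT_of_iso
      (Submodule.quotOfListConsSMulTopEquivQuotSMulTopInner M r rs).symm.toModuleIso _

end ProjectiveDimension

section Grade

universe u v

variable {R : Type u} [CommRing R]

theorem subsingleton_ext_of_isWeaklyRegular [Small.{v} R] {N M : ModuleCat.{v} R} {rs : List R}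
    (reg : IsWeaklyRegular M rs) (hN : ∀ r ∈ rs, r ∈ Module.annihilator R N) {i : ℕ}
    (hi : i < rs.length) : Subsingleton (Ext N M i) := by
  induction rs generalizing M i with
  | nil => simp at hi
  | cons r rs ih =>
    obtain ⟨hr, hrs⟩ := (isWeaklyRegular_cons_iff M r rs).1 reg
    obtain ⟨hrN, hrsN⟩ := List.forall_mem_cons.1 hN
    have hS := hr.smulShortComplex_shortExact
    cases i with
    | zero =>
      have : Subsingleton (N →ₗ[R] M) := hr.linearMap_subsingleton_of_mem_annihilator hrN
      exact (Ext.addEquiv₀.trans ModuleCat.homAddEquiv).subsingleton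
    | succ i =>
      have : Subsingleton (Ext N (M.smulShortComplex r).X₃ i) :=
        ih (M := .of R (QuotSMulTop r M)) hrs hrsN (Nat.lt_of_succ_lt_succ hi)
      refine subsingleton_of_forall_eq 0 fun x => ?_
      have smul_x : x.comp (Ext.mk₀ (M.smulShortComplex r).f) (add_zero (i + 1)) = 0 :=
        congr($(Ext.postcomp_smul_id_eq_zero_of_mem_annihilator (M := M) hrN (i + 1)).hom x)
      obtain ⟨y, rfl⟩ := Ext.covariant_sequence_exact₁ N hS x smul_x rfl
      obtain rfl := Subsingleton.elim y 0
      exact Ext.zero_comp N i hS.extClass _ rfl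

theorem isWeaklyRegular_of_flat (M : Type*) [AddCommGroup M] [Module R M] [Module.Flat R M]
    {rs : List R} (reg : IsWeaklyRegular R rs) : IsWeaklyRegular M rs :=
  ((TensorProduct.rid R M).isWeaklyRegular_congr rs).1 reg.isWeaklyRegular_lTensor

theorem subsingleton_ext_of_hasProjectiveDimensionLE [Small.{v} R] {N M : ModuleCat.{v} R}
    {rs : List R} (reg : IsWeaklyRegular R rs) (hN : ∀ r ∈ rs, r ∈ Module.annihilator R N)
    {p : ℕ} (hM : HasProjectiveDimensionLE M p) {i : ℕ} (hi : i + p < rs.length) :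
    Subsingleton (Ext N M i) := by
  have of_projective (P : ModuleCat.{v} R) [Module.Projective R P] {j : ℕ} (hj : j < rs.length) :
      Subsingleton (Ext N P j) :=
    subsingleton_ext_of_isWeaklyRegular (isWeaklyRegular_of_flat P reg) hN hj
  induction p generalizing M i with
  | zero =>
    have : Module.Projective R M := (IsProjective.iff_projective M).2
      ((projective_iff_hasProjectiveDimensionLE_zero M).2 hM)
    exact of_projective M hi
  | succ p ih =>
    have hS := M.shortExact_projectiveShortComplex
    have : Module.Projective R M.projectiveShortComplex.X₂ := inferInstance
    have := of_projective M.projectiveShortComplex.X₂ (j := i) (by lia)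
    have := ih ((hS.hasProjectiveDimensionLT_X₃_iff p inferInstance).1 hM) (i := i + 1) (by lia)
    refine subsingleton_of_forall_eq 0 fun x => ?_
    obtain ⟨y, rfl⟩ := Ext.covariant_sequence_exact₃ N hS x rfl (Subsingleton.elim _ _)
    rw [Subsingleton.elim y 0, Ext.zero_comp]

theorem exists_forall_eq_smul_of_subsingleton_ext_one {J : Ideal R} {M : Type u} [AddCommGroup M]
    [Module R M] [Subsingleton (Ext (ModuleCat.of R (R ⧸ J)) (ModuleCat.of R M) 1)]
    (φ : J →ₗ[R] M) : ∃ m : M, ∀ x : J, φ x = (x : R) • m := by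
  have hexact := LinearMap.exact_subtype_mkQ J
  have hS := ModuleCat.shortComplex_shortExact
    (ModuleCat.shortComplexOfCompEqZero J.subtype J.mkQ hexact.linearMap_comp_eq_zero)
    hexact J.injective_subtype J.mkQ_surjective
  obtain ⟨e, he⟩ := Ext.contravariant_sequence_exact₁ hS (ModuleCat.of R M)
    (Ext.mk₀ (ModuleCat.ofHom φ)) (add_zero 1) (Subsingleton.elim _ _)
  obtain ⟨ψ, rfl⟩ := (Ext.mk₀_bijective _ _).2 e
  rw [Ext.mk₀_comp_mk₀, (Ext.mk₀_bijective _ _).1.eq_iff] at he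
  refine ⟨ψ.hom (1 : R), fun x => ?_⟩
  have ψ_x : ψ.hom (x : R) = φ x := congr($(he).hom x)
  rw [← ψ_x, ← map_smul, smul_eq_mul, mul_one]

theorem exists_forall_mul_mem_of_subsingleton_ext_one {a b I : Ideal R} (hab : a ⊓ b ≤ I)
    [Subsingleton (Ext (ModuleCat.of R (R ⧸ (a ⊔ b))) (ModuleCat.of R (R ⧸ I)) 1)] :
    ∃ c : R, (∀ x ∈ a, x * (1 - c) ∈ I) ∧ ∀ y ∈ b, y * c ∈ I := by
  let f : R →ₗ.[R] R ⧸ I := ⟨a, I.mkQ ∘ₗ a.subtype⟩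
  let g : R →ₗ.[R] R ⧸ I := ⟨b, 0⟩
  have agree (x : f.domain) (y : g.domain) (hxy : (x : R) = y) : f x = g y :=
    (Submodule.Quotient.mk_eq_zero I).2 (hab ⟨x.2, show (x : R) ∈ b from hxy ▸ y.2⟩)
  obtain ⟨c, hc⟩ := exists_forall_eq_smul_of_subsingleton_ext_one (J := a ⊔ b)
    (f.sup g agree).toFun
  obtain ⟨c, rfl⟩ := I.mkQ_surjective c
  refine ⟨c, fun x hx => ?_, fun y hy => ?_⟩
  · have h : f ⟨x, hx⟩ = x • I.mkQ c :=
      ((f.left_le_sup g agree).2 rfl).trans (hc ⟨x, Submodule.mem_sup_left hx⟩)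
    rw [mul_sub, mul_one]
    exact (Submodule.Quotient.eq I).1 h
  · have h : g ⟨y, hy⟩ = y • I.mkQ c :=
      ((f.right_le_sup g agree).2 rfl).trans (hc ⟨y, Submodule.mem_sup_right hy⟩)
    exact (Submodule.Quotient.mk_eq_zero I).1 h.symm

theorem length_le_of_hasProjectiveDimensionLE_quotient {a b I : Ideal R} (hab : a ⊓ b ≤ I)
    (hI : ¬ ∃ c : R, (∀ x ∈ a, x * (1 - c) ∈ I) ∧ ∀ y ∈ b, y * c ∈ I)
    {rs : List R} (reg : IsWeaklyRegular R rs) (hrs : ∀ r ∈ rs, r ∈ a ⊔ b) {p : ℕ}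
    (hp : HasProjectiveDimensionLE (ModuleCat.of R (R ⧸ I)) p) : rs.length ≤ p + 1 := by
  by_contra! hlt
  have : Subsingleton (Ext (ModuleCat.of R (R ⧸ (a ⊔ b))) (ModuleCat.of R (R ⧸ I)) 1) :=
    subsingleton_ext_of_hasProjectiveDimensionLE reg
      (fun r hr => Ideal.annihilator_quotient.ge (hrs r hr)) hp (by lia)
  exact hI (exists_forall_mul_mem_of_subsingleton_ext_one hab)

end Grade

section Variables

open MvPolynomial

variable {σ R : Type*} [CommRing R]

theorem forall_mem_support_X_mul {p : (σ →₀ ℕ) → Prop} {i : σ} {f : MvPolynomial σ R} :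
    (∀ m ∈ (X i * f).support, p m) ↔ ∀ m ∈ f.support, p (Finsupp.single i 1 + m) := by
  simp [support_X_mul]

theorem single_one_add_apply_ne_zero {i j : σ} {m : σ →₀ ℕ} :
    (Finsupp.single i 1 + m : σ →₀ ℕ) j ≠ 0 ↔ j = i ∨ m j ≠ 0 := by
  classical
  rw [Finsupp.add_apply, Finsupp.single_apply]
  grind

theorem single_one_add_le_iff {i : σ} {m n : σ →₀ ℕ} (hm : m i = 0) :
    Finsupp.single i 1 + m ≤ n ↔ n i ≠ 0 ∧ m ≤ n := by
  classical
  simp only [Finsupp.le_def, Finsupp.add_apply, Finsupp.single_apply]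
  grind

theorem X_mul_mem_span_X_image {S : Set σ} {i : σ} (hi : i ∉ S) {f : MvPolynomial σ R} :
    X i * f ∈ Ideal.span (X '' S) ↔ f ∈ Ideal.span (X '' S) := by
  simp only [mem_ideal_span_X_image, forall_mem_support_X_mul, single_one_add_apply_ne_zero]
  grind

theorem ofList_map_X_smul_top (l : List σ) :
    (Ideal.ofList (l.map X : List (MvPolynomial σ R)) • ⊤ : Ideal (MvPolynomial σ R)) =
      Ideal.span (X '' {i | i ∈ l}) := by
  rw [smul_eq_mul, Ideal.mul_top, Ideal.ofList]
  simp only [List.mem_map, Set.image, Set.mem_ofPred_eq]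

theorem isWeaklyRegular_map_X {l : List σ} (hl : l.Nodup) :
    IsWeaklyRegular (MvPolynomial σ R) (l.map X : List (MvPolynomial σ R)) := by
  rw [isWeaklyRegular_iff]
  intro n hn
  rw [← List.map_take, ofList_map_X_smul_top, List.getElem_map,
    isSMulRegular_quotient_iff_mem_of_smul_mem]
  intro f hf
  rw [List.length_map] at hn
  have not_mem_take : l[n] ∉ l.take n := by
    rw [List.mem_take_iff_getElem]
    grind [hl.getElem_inj_iff]
  exact (X_mul_mem_span_X_image (S := {i | i ∈ l.take n}) not_mem_take).1 hf

theorem hasProjectiveDimensionLE_quotient_span_X_image (S : Finset σ) :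
    HasProjectiveDimensionLE
      (ModuleCat.of (MvPolynomial σ R)
        (MvPolynomial σ R ⧸ (Ideal.span (X '' S) : Ideal (MvPolynomial σ R)))) S.card := by
  have setOf_mem_toList : {i | i ∈ S.toList} = (S : Set σ) := Set.ext fun _ => Finset.mem_toList
  have h := hasProjectiveDimensionLT_quotient_of_isWeaklyRegular (n := 1)
    (ModuleCat.of (MvPolynomial σ R) (MvPolynomial σ R)) (isWeaklyRegular_map_X S.nodup_toList)
  rwa [ofList_map_X_smul_top, setOf_mem_toList, List.length_map, Finset.length_toList,
    add_comm] at h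

end Variables

section GraphIdeal

open MvPolynomial

variable (k : Type*) [Field k] {V : Type*} (G : SimpleGraph V)

/-- The ideal generated by the edges of `G` and the variables in `S`. These are the ideals that
arise from `graphIdeal k G` by repeatedly adjoining variables and dividing by variables. -/
noncomputable def graphVertexIdeal (S : Set V) : Ideal (MvPolynomial V k) :=
  graphIdeal k G ⊔ Ideal.span (X '' S)

theorem graphVertexIdeal_empty : graphVertexIdeal k G ∅ = graphIdeal k G := by
  rw [graphVertexIdeal, Set.image_empty, Ideal.span_empty, sup_bot_eq]

theorem graphVertexIdeal_insert (S : Set V) (v : V) :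
    graphVertexIdeal k G (insert v S) = graphVertexIdeal k G S ⊔ Ideal.span {X v} := by
  rw [graphVertexIdeal, graphVertexIdeal, Set.image_insert_eq, Ideal.span_insert, sup_assoc,
    sup_comm (Ideal.span {X v})]

theorem graphVertexIdeal_eq_span_monomial (S : Set V) :
    graphVertexIdeal k G S = Ideal.span ((fun m => monomial m (1 : k)) ''
      ({m | ∃ i j, G.Adj i j ∧ m = Finsupp.single i 1 + Finsupp.single j 1} ∪
        (fun i => Finsupp.single i 1) '' S)) := by
  have edges : {f : MvPolynomial V k | ∃ i j, G.Adj i j ∧ f = X i * X j} =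
      (fun m => monomial m (1 : k)) ''
        {m | ∃ i j, G.Adj i j ∧ m = Finsupp.single i 1 + Finsupp.single j 1} := by
    ext f
    simp only [Set.mem_ofPred_eq, Set.mem_image, X, monomial_mul, mul_one]
    grind
  rw [Set.image_union, Ideal.span_union, ← edges, Set.image_image]
  rfl

variable {k G}

theorem mem_graphVertexIdeal {S : Set V} {f : MvPolynomial V k} :
    f ∈ graphVertexIdeal k G S ↔ ∀ m ∈ f.support,
      (∃ i ∈ S, m i ≠ 0) ∨ ∃ i j, G.Adj i j ∧ m i ≠ 0 ∧ m j ≠ 0 := by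
  have single_le {m : V →₀ ℕ} {i : V} : Finsupp.single i 1 ≤ m ↔ m i ≠ 0 := by
    rw [Finsupp.single_le_iff, Nat.one_le_iff_ne_zero]
  have single_add_single_le {m : V →₀ ℕ} {i j : V} (hij : G.Adj i j) :
      Finsupp.single i 1 + Finsupp.single j 1 ≤ m ↔ m i ≠ 0 ∧ m j ≠ 0 := by
    rw [single_one_add_le_iff (Finsupp.single_eq_of_ne hij.ne), single_le]
  rw [graphVertexIdeal_eq_span_monomial, mem_ideal_span_monomial_image]
  refine forall₂_congr fun m _ => ?_
  constructor
  · rintro ⟨_, ⟨i, j, hij, rfl⟩ | ⟨i, hi, rfl⟩, hm⟩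
    · exact .inr ⟨i, j, hij, (single_add_single_le hij).1 hm⟩
    · exact .inl ⟨i, hi, single_le.1 hm⟩
  · rintro (⟨i, hi, hm⟩ | ⟨i, j, hij, hm⟩)
    · exact ⟨_, .inr ⟨i, hi, rfl⟩, single_le.2 hm⟩
    · exact ⟨_, .inl ⟨i, j, hij, rfl⟩, (single_add_single_le hij).2 hm⟩

theorem mem_graphIdeal {f : MvPolynomial V k} :
    f ∈ graphIdeal k G ↔ ∀ m ∈ f.support, ∃ i j, G.Adj i j ∧ m i ≠ 0 ∧ m j ≠ 0 := by
  simp only [← graphVertexIdeal_empty, mem_graphVertexIdeal, Set.mem_empty_iff_false, false_and,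
    exists_false, false_or]

theorem graphIdeal_ne_top : graphIdeal k G ≠ ⊤ := by
  simp [Ideal.ne_top_iff_one, mem_graphIdeal]

theorem constantCoeff_eq_zero_of_X_mul_mem_graphIdeal {f : MvPolynomial V k} {v : V}
    (h : X v * f ∈ graphIdeal k G) : constantCoeff f = 0 := by
  by_contra hf
  rw [mem_graphIdeal, forall_mem_support_X_mul] at h
  obtain ⟨i, j, hij, hi, hj⟩ := h 0 (mem_support_iff.2 hf)
  simp only [single_one_add_apply_ne_zero, Finsupp.coe_zero, Pi.zero_apply, ne_eq,
    not_true_eq_false, or_false] at hi hj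
  exact hij.ne (hi.trans hj.symm)

theorem not_exists_multiplier_graphIdeal {A B : Set V} (hA : A.Nonempty) (hB : B.Nonempty) :
    ¬ ∃ c : MvPolynomial V k,
      (∀ x ∈ Ideal.span (X '' A), x * (1 - c) ∈ graphIdeal k G) ∧
        ∀ y ∈ Ideal.span (X '' B), y * c ∈ graphIdeal k G := by
  rintro ⟨c, hcA, hcB⟩
  obtain ⟨a, ha⟩ := hA
  obtain ⟨b, hb⟩ := hB
  have constantCoeff_one_sub : constantCoeff (1 - c) = 0 :=
    constantCoeff_eq_zero_of_X_mul_mem_graphIdeal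
      (hcA _ (Ideal.subset_span (Set.mem_image_of_mem X ha)))
  have constantCoeff_c : constantCoeff c = 0 :=
    constantCoeff_eq_zero_of_X_mul_mem_graphIdeal
      (hcB _ (Ideal.subset_span (Set.mem_image_of_mem X hb)))
  rw [map_sub, map_one, constantCoeff_c, sub_zero] at constantCoeff_one_sub
  exact one_ne_zero constantCoeff_one_sub

theorem span_X_image_inf_le_graphIdeal {A B : Set V} (hAB : ∀ a ∈ A, ∀ b ∈ B, G.Adj a b) :
    Ideal.span (X '' A) ⊓ Ideal.span (X '' B) ≤ graphIdeal k G := by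
  rintro f ⟨hfA, hfB⟩
  refine mem_graphIdeal.2 fun m hm => ?_
  obtain ⟨i, hi, him⟩ := mem_ideal_span_X_image.1 hfA m hm
  obtain ⟨j, hj, hjm⟩ := mem_ideal_span_X_image.1 hfB m hm
  exact ⟨i, j, hAB i hi j hj, him, hjm⟩

theorem graphVertexIdeal_colon_X {S : Set V} {v : V} (hv : v ∉ S) :
    (graphVertexIdeal k G S).colon {X v} = graphVertexIdeal k G (S ∪ G.neighborSet v) := by
  ext f
  rw [Submodule.mem_colon_singleton, smul_eq_mul, mul_comm, mem_graphVertexIdeal,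
    mem_graphVertexIdeal, forall_mem_support_X_mul]
  refine forall₂_congr fun m _ => ?_
  simp only [single_one_add_apply_ne_zero, Set.mem_union, SimpleGraph.mem_neighborSet]
  grind [G.adj_comm, G.irrefl]

theorem graphVertexIdeal_eq_span_of_isVertexCover {S : Set V} (hS : G.IsVertexCover S) :
    graphVertexIdeal k G S = Ideal.span (X '' S) := by
  refine sup_eq_right.2 (Ideal.span_le.2 ?_)
  rintro _ ⟨i, j, hij, rfl⟩
  obtain hi | hj := hS hij
  · exact Ideal.mul_mem_right _ _ (Ideal.subset_span (Set.mem_image_of_mem X hi))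
  · exact Ideal.mul_mem_left _ _ (Ideal.subset_span (Set.mem_image_of_mem X hj))

end GraphIdeal

section Join

variable {V : Type*} {G : SimpleGraph V}

theorem not_preconnected_compl_iff_exists_join :
    ¬ Gᶜ.Preconnected ↔ ∃ A : Set V, A.Nonempty ∧ Aᶜ.Nonempty ∧ ∀ a ∈ A, ∀ b ∈ Aᶜ, G.Adj a b := by
  constructor
  · intro h
    simp only [SimpleGraph.Preconnected, not_forall] at h
    obtain ⟨u, v, huv⟩ := h
    refine ⟨{w | Gᶜ.Reachable u w}, ⟨u, .rfl⟩, ⟨v, huv⟩, fun a ha b hb => ?_⟩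
    by_contra hab
    exact hb (ha.trans (SimpleGraph.Adj.reachable ⟨ne_of_mem_of_not_mem ha hb, hab⟩))
  · rintro ⟨A, ⟨a, ha⟩, ⟨b, hb⟩, join⟩ h
    obtain ⟨p⟩ := h a b
    obtain ⟨d, -, hd, hd'⟩ := p.exists_boundary_dart A ha hb
    exact d.adj.2 (join _ hd _ hd')

theorem not_preconnected_compl_top [Nontrivial V] : ¬ (⊤ : SimpleGraph V)ᶜ.Preconnected := by
  rw [compl_top]
  exact SimpleGraph.not_preconnected_bot

theorem not_preconnected_compl_completeBipartiteGraph {α β : Type*} [Nonempty α] [Nonempty β] :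
    ¬ (completeBipartiteGraph α β)ᶜ.Preconnected := by
  refine not_preconnected_compl_iff_exists_join.2 ⟨Set.range Sum.inl, Set.range_nonempty _, ?_, ?_⟩
  · rw [Set.compl_range_inl]
    exact Set.range_nonempty _
  · simp [Set.compl_range_inl]

end Join

section GraphPd

open MvPolynomial

variable {k : Type*} [Field k] {V : Type*} {G : SimpleGraph V}

theorem hasProjectiveDimensionLT_quotient_graphVertexIdeal [Finite V] {S : Set V}
    (hS : S ≠ Set.univ) :
    HasProjectiveDimensionLT (ModuleCat.of (MvPolynomial V k)
      (MvPolynomial V k ⧸ graphVertexIdeal k G S)) (Nat.card V) := by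
  induction S using WellFoundedGT.induction with
  | ind S ih =>
  by_cases hcover : G.IsVertexCover S
  · rw [graphVertexIdeal_eq_span_of_isVertexCover hcover]
    have := hasProjectiveDimensionLE_quotient_span_X_image (R := k) S.toFinite.toFinset
    rw [S.toFinite.coe_toFinset, ← Set.ncard_eq_toFinset_card] at this
    exact hasProjectiveDimensionLT_of_ge _ _ _ (Set.ncard_lt_card hS)
  · obtain ⟨v, w, hvw, hv, hw⟩ : ∃ v w, G.Adj v w ∧ v ∉ S ∧ w ∉ S := by
      simpa [SimpleGraph.IsVertexCover] using hcover
    refine (colonShortComplex_shortExact (graphVertexIdeal k G S) (X v)).hasProjectiveDimensionLT_X₂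
      _ ?_ ?_
    · have := ih (S ∪ G.neighborSet v) (Set.ssubset_iff_of_subset Set.subset_union_left |>.2
        ⟨w, Or.inr hvw, hw⟩) fun h => (h.ge (Set.mem_univ v)).elim hv G.irrefl
      rwa [← graphVertexIdeal_colon_X hv] at this
    · have := ih (insert v S) (Set.ssubset_insert hv)
        fun h => (h.ge (Set.mem_univ w)).elim hvw.ne' hw
      rwa [graphVertexIdeal_insert] at this

theorem graphPd_le [Nonempty V] : graphPd k G ≤ (ENat.card V - 1 : ℕ∞) := by
  cases finite_or_infinite V
  · have h := hasProjectiveDimensionLT_quotient_graphVertexIdeal (k := k) (G := G)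
      Set.empty_ne_univ
    rw [graphVertexIdeal_empty, ← Nat.sub_add_cancel (Nat.card_pos (α := V))] at h
    rw [ENat.card_eq_coe_natCard]
    exact (projectiveDimension_le_iff _ _).2 h
  · simp

theorem encard_union_sub_one_le_graphPd {A B : Set V} (hA : A.Nonempty) (hB : B.Nonempty)
    (hAB : ∀ a ∈ A, ∀ b ∈ B, G.Adj a b) :
    (((A ∪ B).encard - 1 : ℕ∞) : WithBot ℕ∞) ≤ graphPd k G := by
  refine coe_le_projectiveDimension ?_ fun p hp => tsub_le_iff_right.2 ?_
  · rw [ModuleCat.isZero_iff_subsingleton]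
    exact mt Ideal.Quotient.subsingleton_iff.1 graphIdeal_ne_top
  refine ENat.forall_natCast_le_iff_le.1 fun n hn => ?_
  obtain ⟨F, hF, hFn⟩ := Set.exists_subset_encard_eq hn
  lift F to Finset V using Set.finite_of_encard_eq_coe hFn
  have F_length : (F.toList.map (X (R := k))).length = n := by
    rw [List.length_map, Finset.length_toList]
    exact_mod_cast (Set.encard_coe_eq_coe_finsetCard F).symm.trans hFn
  rw [← F_length]
  refine mod_cast length_le_of_hasProjectiveDimensionLE_quotient
    (span_X_image_inf_le_graphIdeal hAB) (not_exists_multiplier_graphIdeal hA hB)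
    (isWeaklyRegular_map_X F.nodup_toList) ?_ hp
  simp only [List.mem_map, Finset.mem_toList, ← Ideal.span_union, ← Set.image_union]
  rintro _ ⟨v, hv, rfl⟩
  exact Ideal.subset_span (Set.mem_image_of_mem X (hF hv))

theorem le_graphPd_of_isIndContained {W : Type*} {H : SimpleGraph W} (hH : ¬ Hᶜ.Preconnected)
    (h : H.IsIndContained G) : ((ENat.card W - 1 : ℕ∞) : WithBot ℕ∞) ≤ graphPd k G := by
  obtain ⟨A, hA, hB, join⟩ := not_preconnected_compl_iff_exists_join.1 hH
  obtain ⟨f⟩ := h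
  have hle := encard_union_sub_one_le_graphPd (k := k) (hA.image f) (hB.image f) <| by
    rintro _ ⟨a, ha, rfl⟩ _ ⟨b, hb, rfl⟩
    exact f.map_adj_iff.2 (join a ha b hb)
  rwa [← Set.image_union, Set.union_compl_self, f.injective.encard_image, Set.encard_univ] at hle

theorem graphPd_eq_of_not_preconnected_compl (h : ¬ Gᶜ.Preconnected) :
    graphPd k G = (ENat.card V - 1 : ℕ∞) := by
  obtain ⟨_, ⟨v, _⟩, -⟩ := not_preconnected_compl_iff_exists_join.1 h
  have : Nonempty V := ⟨v⟩
  exact graphPd_le.antisymm (le_graphPd_of_isIndContained h .rfl)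

end GraphPd

theorem mainTheorem9_general (k : Type*) [Field k] :
    (∀ (V : Type*) (G : SimpleGraph V),
      (∀ W : Set V, ¬ (G.induce W)ᶜ.Preconnected →
        ((W.encard - 1 : ℕ∞) : WithBot ℕ∞) ≤ graphPd k G) ∧
      (¬ Gᶜ.Preconnected → graphPd k G = (ENat.card V - 1 : ℕ∞)) ∧
      (∀ α : Type*, Nontrivial α → (⊤ : SimpleGraph α).IsIndContained G →
        ((ENat.card α - 1 : ℕ∞) : WithBot ℕ∞) ≤ graphPd k G) ∧
      (∀ α β : Type*, Nonempty α → Nonempty β → (completeBipartiteGraph α β).IsIndContained G →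
        ((ENat.card α + ENat.card β - 1 : ℕ∞) : WithBot ℕ∞) ≤ graphPd k G)) ∧
    (∀ α : Type*, Nontrivial α →
      graphPd k (⊤ : SimpleGraph α) = (ENat.card α - 1 : ℕ∞)) ∧
    (∀ α β : Type*, Nonempty α → Nonempty β →
      graphPd k (completeBipartiteGraph α β) = (ENat.card α + ENat.card β - 1 : ℕ∞)) := by
  simp only [← ENat.card_sum]
  exact ⟨fun V G =>
    ⟨fun W hW => le_graphPd_of_isIndContained hW ⟨.induce W⟩,
      graphPd_eq_of_not_preconnected_compl,
      fun α _ => le_graphPd_of_isIndContained not_preconnected_compl_top,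
      fun α β _ _ => le_graphPd_of_isIndContained not_preconnected_compl_completeBipartiteGraph⟩,
    fun α _ => graphPd_eq_of_not_preconnected_compl not_preconnected_compl_top,
    fun α β _ _ =>
      graphPd_eq_of_not_preconnected_compl not_preconnected_compl_completeBipartiteGraph⟩

theorem mainTheorem9 (k : Type*) [Field k] :
    (∀ (V : Type*) [Fintype V] (G : SimpleGraph V),
      (∀ W : Finset V, ¬ (G.induce (W : Set V))ᶜ.Preconnected →
        ((W.card - 1 : ℕ) : WithBot ℕ∞) ≤ graphPd k G) ∧
      (¬ Gᶜ.Preconnected → graphPd k G = ((Fintype.card V - 1 : ℕ) : WithBot ℕ∞)) ∧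
      (∀ n : ℕ, 2 ≤ n → (⊤ : SimpleGraph (Fin n)).IsIndContained G →
        ((n - 1 : ℕ) : WithBot ℕ∞) ≤ graphPd k G) ∧
      (∀ n m : ℕ, 1 ≤ n → 1 ≤ m → (completeBipartiteGraph (Fin n) (Fin m)).IsIndContained G →
        ((n + m - 1 : ℕ) : WithBot ℕ∞) ≤ graphPd k G)) ∧
    (∀ n : ℕ, 2 ≤ n →
      graphPd k (⊤ : SimpleGraph (Fin n)) = ((n - 1 : ℕ) : WithBot ℕ∞)) ∧
    (∀ n m : ℕ, 1 ≤ n → 1 ≤ m →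
      graphPd k (completeBipartiteGraph (Fin n) (Fin m)) =
        ((n + m - 1 : ℕ) : WithBot ℕ∞)) := by
  have coe_sub_one (n : ℕ) : ((n - 1 : ℕ) : WithBot ℕ∞) = ((n - 1 : ℕ∞) : WithBot ℕ∞) := rfl
  have nontrivial {n : ℕ} (hn : 2 ≤ n) : Nontrivial (Fin n) := Fin.nontrivial_iff_two_le.2 hn
  have nonempty {n : ℕ} (hn : 1 ≤ n) : Nonempty (Fin n) := Fin.pos_iff_nonempty.1 hn
  obtain ⟨general, complete, bipartite⟩ := mainTheorem9_general k
  refine ⟨fun V _ G => ?_, fun n hn => ?_, fun n m hn hm => ?_⟩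
  · obtain ⟨h₁, h₂, h₃, h₄⟩ := general V G
    refine ⟨fun W hW => ?_, fun hG => ?_, fun n hn h => ?_, fun n m hn hm h => ?_⟩
    · simpa [coe_sub_one] using h₁ W hW
    · simpa [coe_sub_one] using h₂ hG
    · simpa [coe_sub_one] using h₃ (Fin n) (nontrivial hn) h
    · simpa [coe_sub_one] using h₄ (Fin n) (Fin m) (nonempty hn) (nonempty hm) h
  · simpa [coe_sub_one] using complete (Fin n) (nontrivial hn)
  · simpa [coe_sub_one] using bipartite (Fin n) (Fin m) (nonempty hn) (nonempty hm)
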